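/- **Theorem.** Let $U\subset\mathbb{A}^3_{\mathbb{Q}}$ be the affine cubic surface $$x_1^3+x_2^3+x_3^3+21(x_1+x_2+x_3)-50=0 .$$ For a place $v$ of $\mathbb{Q}$ let $\mathbb{Q}_v$ be the completion ($\mathbb{R}$ or $\mathbb{Q}_p$) and give $U(\mathbb{Q}_v)\subset\mathbb{Q}_v^3$ the $v$-adic topology. For a finite set $S$ of places let $U(\mathbb{A}^S_{\mathbb{Q}})$ be the set of families $(x_v)\in\prod_{v\notin S}U(\mathbb{Q}_v)$ such that, for all but finitely many $v\notin S$, all coordinates of $x_v$ are $v$-adic integers, with the restricted product topology. 1. $U$ fails weak approximation: the diagonal image of $U(\mathbb{Q})$ in $\prod_v U(\mathbb{Q}_v)$, the product over all places $v$ of $\mathbb{Q}$ with the product topology, is not dense. 2. $U$ fails strong approximation: for every finite set $S$ of places of $\mathbb{Q}$ that does not contain the place $2$ (in particular for $S=\emptyset$ and for $S=\{\infty\}$), the diagonal image of $U(\mathbb{Q})$ in $U(\mathbb{A}^S_{\mathbb{Q}})$ is not dense. 3. Let $\alpha=\left(\left(2+\frac{x_3}{x_1}\right)\frac{x_3}{x_1},\,-6\right)$,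 a quaternion algebra over the function field of $U$. As $x$ runs over the points of $U(\mathbb{R})$ with $x_1\neq 0$ and $\left(2+\frac{x_3}{x_1}\right)\frac{x_3}{x_1}\neq 0$, the invariant $\mathrm{inv}_\infty(\alpha(x))\in\mathbb{Q}/\mathbb{Z}$ of the specialised quaternion algebra over $\mathbb{R}$ ($0$ if it is split, $\tfrac12$ if it is not) takes exactly the two values $0$ and $\tfrac12$. -/

import Mathlib

open scoped RestrictedProduct Quaternion

noncomputable section

/-- The places of `ℚ`: the real place and one place for every prime number. -/
inductive RatPlace : Type
  | infinite : RatPlace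
  | finite (p : ℕ) [hp : Fact p.Prime] : RatPlace

namespace RatPlace

/-- The completion `ℚ_v`. -/
def Completion : RatPlace → Type
  | infinite => ℝ
  | finite p => ℚ_[p]

instance (v : RatPlace) : NormedField v.Completion :=
  match v with
  | infinite => inferInstanceAs (NormedField ℝ)
  | finite p => inferInstanceAs (NormedField ℚ_[p])

instance (v : RatPlace) : Algebra ℚ v.Completion :=
  match v with
  | infinite => inferInstanceAs (Algebra ℚ ℝ)
  | finite p => inferInstanceAs (Algebra ℚ ℚ_[p])

/-- The elements `x` of `ℚ_v` with `v(x) ≥ 0`: the ring `ℤ_p` for the place of `p`, and no condition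
at the real place (which does not affect conditions imposed at almost all places). -/
def integers : (v : RatPlace) → Set v.Completion
  | infinite => Set.univ
  | finite p => {x : ℚ_[p] | ‖x‖ ≤ 1}

/-- A rational number is integral at almost all places. -/
theorem finite_not_mem_integers (q : ℚ) :
    {v : RatPlace | algebraMap ℚ v.Completion q ∉ v.integers}.Finite := by
  have hD : {p : ℕ | p ∣ q.den}.Finite :=
    (Set.finite_Iic q.den).subset fun p hp => Nat.le_of_dvd q.den_pos hp
  let c : RatPlace → ℕ := fun v => match v with
    | infinite => 0
    | finite p => p
  refine Set.Finite.of_finite_image (f := c) (hD.subset ?_) ?_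
  · rintro _ ⟨v, hv, rfl⟩
    cases v with
    | infinite => exact absurd (Set.mem_univ _) hv
    | finite p =>
      by_contra hp
      refine hv ?_
      change ‖algebraMap ℚ ℚ_[p] q‖ ≤ 1
      rw [eq_ratCast]
      exact Padic.norm_rat_le_one hp
  · intro v hv w hw hvw
    cases v with
    | infinite => exact absurd (Set.mem_univ _) hv
    | finite p =>
      cases w with
      | infinite => exact absurd (Set.mem_univ _) hw
      | finite p' =>
        change p = p' at hvw
        subst hvw
        rfl

end RatPlace

/-! An affine variety over `ℚ` in affine space with coordinates indexed by `σ` is given by an ideal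
`I`, and `MvPolynomial.zeroLocus K I` is its set of `K`-points. -/

section Approximation

variable {σ : Type} (I : Ideal (MvPolynomial σ ℚ))

/-- The map `U(ℚ) → U(ℚ_v)`. -/
def ratToLocal (v : RatPlace) (x : MvPolynomial.zeroLocus ℚ I) :
    MvPolynomial.zeroLocus v.Completion I :=
  ⟨fun i => algebraMap ℚ v.Completion (x.1 i), fun f hf => by
    have h := x.2 f hf
    have h2 := MvPolynomial.aeval_algebraMap_apply v.Completion x.1 f
    exact h2.trans (by rw [h, map_zero])⟩

/-- The points of `U(ℚ_v)` all of whose coordinates have non-negative valuation. -/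
def integralPoints (v : RatPlace) : Set (MvPolynomial.zeroLocus v.Completion I) :=
  {x | ∀ i, x.1 i ∈ v.integers}

/-- Weak approximation: `U(ℚ)` is dense in the product of all `U(ℚ_v)`, with the product topology
of the `v`-adic topologies. -/
def SatisfiesWeakApproximation : Prop :=
  DenseRange fun (x : MvPolynomial.zeroLocus ℚ I) (v : RatPlace) => ratToLocal I v x

/-- The adelic points off `S`: families of points of `U(ℚ_v)`, for `v ∉ S`, almost all of which are
integral, with the restricted product topology. -/
abbrev AdelicPointsOff (S : Finset RatPlace) : Type :=
  Πʳ v : {v : RatPlace // v ∉ S},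
    [MvPolynomial.zeroLocus (v : RatPlace).Completion I, integralPoints I (v : RatPlace)]

/-- The diagonal map from `U(ℚ)` to the adelic points off `S`. -/
def diagonal [Finite σ] (S : Finset RatPlace) (x : MvPolynomial.zeroLocus ℚ I) :
    AdelicPointsOff I S :=
  ⟨fun v => ratToLocal I v x, by
    rw [Filter.eventually_cofinite]
    have h : (⋃ i, {v : RatPlace | algebraMap ℚ v.Completion (x.1 i) ∉ v.integers}).Finite :=
      Set.finite_iUnion fun i => RatPlace.finite_not_mem_integers (x.1 i)
    refine (h.preimage (Subtype.val_injective.injOn (s := Set.univ)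
      |>.mono (Set.subset_univ _))).subset ?_
    intro v hv
    obtain ⟨i, hi⟩ := not_forall.mp hv
    exact Set.mem_iUnion.mpr ⟨i, hi⟩⟩

/-- Strong approximation off `S`: `U(ℚ)` is dense in the adelic points off `S`. -/
def SatisfiesStrongApproximationOff [Finite σ] (S : Finset RatPlace) : Prop :=
  DenseRange (diagonal I S)

end Approximation

/-- The ideal of the affine surface `x₁³ + x₂³ + x₃³ + 21 (x₁ + x₂ + x₃) - 50 = 0`; the coordinates
`x₁, x₂, x₃` have the indices `0, 1, 2`. -/
def surfaceU50 : Ideal (MvPolynomial (Fin 3) ℚ) :=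
  Ideal.span {MvPolynomial.X 0 ^ 3 + MvPolynomial.X 1 ^ 3 + MvPolynomial.X 2 ^ 3
    + 21 * (MvPolynomial.X 0 + MvPolynomial.X 1 + MvPolynomial.X 2) - 50}

open Classical in
/-- The invariant in `ℚ/ℤ` of the class in `Br ℝ` of the quaternion algebra `(a, b)` over `ℝ`, for
`a, b ≠ 0`: it is `0` if the algebra is split and `1/2` otherwise. -/
def realInvariant (a b : ℝ) : AddCircle (1 : ℚ) :=
  if Nonempty (ℍ[ℝ, a, b] ≃ₐ[ℝ] Matrix (Fin 2) (Fin 2) ℝ) then 0 else ((1 / 2 : ℚ) : AddCircle (1 : ℚ))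

end

/-! This is a Brauer–Manin obstruction at 2. With s = x₁ + x₂ + x₃, the identity s³ - Σxᵢ³ = 3∏(xᵢ +
xⱼ) turns the equation into 3∏(xᵢ + xⱼ) = (s - 2)((s + 1)² + 24), whose last factor is a norm from
ℚ(√-6). After clearing a common denominator e, let Rᵢ be 2-term sums of the numerators, D = 2(s -
2)e and Z = 2e. The numbers nᵢ = Rᵢ(D - Rᵢ) have pairwise products that are norms up to squares
(`surface_norm_identity`), so where they are nonzero the Hilbert symbols (nᵢ, -6)_v agree, and at
each place the most convenient i may be used.

The symbol is trivial at every prime other than 2 and 3 (`exists_even_padicValInt_of_surface`), and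
is -1 at 3 (`exists_mod_three_eq_two_of_surface`) and at ∞ (`exists_nonpos_of_surface`).
Reciprocity, used through the Jacobi symbol of -6 over |nᵢ| in `false_of_neg_of_mod_three`, forces
it to be 1 at 2. It is -1 on the 2-adic ball around (1, 1, 22), which meets U(ℚ₂) by Hensel's lemma.
So U(ℚ) is not dense in U(ℚ₂), and both kinds of approximation fail.

The claim on α is independent of this: its real invariant is decided by a sign, and two rational
points realise both signs. -/

/-! ### Jacobi symbols and values of the form a² + 6b² -/

/-- If every prime at which `a` is a non-residue occurs in `m` with even exponent, the Jacobi symbol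
`(a / m)` is `1`. -/
theorem jacobiSym_eq_one_of_even_padicValNat (a : ℤ) (m : ℕ) (hm : m ≠ 0) (hcop : IsCoprime a m)
    (h : ∀ p : ℕ, p.Prime → jacobiSym a p = -1 → Even (padicValNat p m)) :
    jacobiSym a m = 1 := by
  induction m using Nat.recOnPosPrimePosCoprime with
  | zero => exact absurd rfl hm
  | one => simp
  | prime_pow p n hp hn =>
    rw [jacobiSym.pow_right]
    have hcp : IsCoprime a (p : ℤ) :=
      hcop.of_isCoprime_of_dvd_right (by push_cast; exact dvd_pow_self _ hn.ne')
    rcases jacobiSym.eq_one_or_neg_one (Int.isCoprime_iff_gcd_eq_one.mp hcp) with h1 | h1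
    · rw [h1, one_pow]
    · have hv := h p hp h1
      have := Fact.mk hp
      rw [padicValNat.prime_pow] at hv
      rw [h1, hv.neg_one_pow]
  | coprime x y hx hy hxy ihx ihy =>
    have hx0 : x ≠ 0 := by lia
    have hy0 : y ≠ 0 := by lia
    have : NeZero x := ⟨hx0⟩
    have : NeZero y := ⟨hy0⟩
    push_cast at hcop
    have key : ∀ {x y : ℕ}, x ≠ 0 → y ≠ 0 → x.Coprime y → ∀ {p : ℕ}, p.Prime →
        Even (padicValNat p (x * y)) → Even (padicValNat p x) := by
      intro x y hx0 hy0 hxy p hp h1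
      have := Fact.mk hp
      rw [padicValNat.mul hx0 hy0] at h1
      by_cases hpx : p ∣ x
      · have hpy : ¬ p ∣ y := fun hpy =>
          hp.one_lt.ne' (Nat.dvd_one.mp (hxy ▸ Nat.dvd_gcd hpx hpy))
        rwa [padicValNat.eq_zero_of_not_dvd hpy, add_zero] at h1
      · rw [padicValNat.eq_zero_of_not_dvd hpx]; exact Even.zero
    rw [jacobiSym.mul_right,
      ihx hx0 hcop.of_mul_right_left fun p hp hj => key hx0 hy0 hxy hp (h p hp hj),
      ihy hy0 hcop.of_mul_right_right fun p hp hj =>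
        key hy0 hx0 hxy.symm hp (mul_comm x y ▸ h p hp hj), one_mul]

/-- At a prime where `-6` is a non-residue, the form `a² + 6b²` is anisotropic. -/
theorem dvd_and_dvd_of_dvd_sq_add_six_mul_sq {p : ℕ} (hp : p.Prime) (hj : jacobiSym (-6) p = -1)
    {a b : ℤ} (h : (p : ℤ) ∣ a ^ 2 + 6 * b ^ 2) : (p : ℤ) ∣ a ∧ (p : ℤ) ∣ b := by
  have := Fact.mk hp
  have hb : (p : ℤ) ∣ b := by
    by_contra hb
    rw [← jacobiSym.legendreSym.to_jacobiSym, legendreSym.eq_neg_one_iff] at hj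
    apply hj
    have hb' : (b : ZMod p) ≠ 0 := by rwa [Ne, ZMod.intCast_zmod_eq_zero_iff_dvd]
    refine ⟨a / b, ?_⟩
    have h2 : ((a ^ 2 + 6 * b ^ 2 : ℤ) : ZMod p) = 0 := by
      rwa [ZMod.intCast_zmod_eq_zero_iff_dvd]
    push_cast at h2 ⊢
    field_simp
    linear_combination -h2
  refine ⟨?_, hb⟩
  have : (p : ℤ) ∣ a ^ 2 := by
    have h3 : (p : ℤ) ∣ 6 * b ^ 2 := Dvd.dvd.mul_left (dvd_pow hb two_ne_zero) _
    exact (dvd_add_left h3).mp h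
  exact (Nat.prime_iff_prime_int.mp hp).dvd_of_dvd_pow this

/-- Descent: if p divides the value, anisotropy makes p divide both a and b, so a factor p² splits
off. -/
theorem even_padicValInt_sq_add_six_mul_sq {p : ℕ} (hp : p.Prime) (hj : jacobiSym (-6) p = -1)
    (a b : ℤ) : Even (padicValInt p (a ^ 2 + 6 * b ^ 2)) := by
  have := Fact.mk hp
  have hp0 : (p : ℤ) ≠ 0 := by exact_mod_cast hp.ne_zero
  induction hn : (a ^ 2 + 6 * b ^ 2).natAbs using Nat.strong_induction_on generalizing a b with
  | _ n ih =>
  by_cases hd : (p : ℤ) ∣ a ^ 2 + 6 * b ^ 2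
  · obtain ⟨⟨a, rfl⟩, ⟨b, rfl⟩⟩ := dvd_and_dvd_of_dvd_sq_add_six_mul_sq hp hj hd
    have he : (p * a) ^ 2 + 6 * (p * b) ^ 2 = (p : ℤ) * p * (a ^ 2 + 6 * b ^ 2) := by ring
    by_cases h0 : a ^ 2 + 6 * b ^ 2 = 0
    · rw [he, h0]; simp
    · rw [he] at hn ⊢
      rw [padicValInt.mul (mul_ne_zero hp0 hp0) h0, padicValInt.mul hp0 hp0]
      refine Even.add ⟨_, rfl⟩ (ih _ ?_ a b rfl)
      rw [← hn, Int.natAbs_mul]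
      have : 0 < (a ^ 2 + 6 * b ^ 2).natAbs := Int.natAbs_pos.mpr h0
      have h2 : 1 < ((p : ℤ) * p).natAbs := by
        rw [Int.natAbs_mul, Int.natAbs_natCast]; nlinarith [hp.one_lt]
      nlinarith
  · rw [padicValInt.eq_zero_of_not_dvd hd]; exact Even.zero

/-! ### Local conditions at the real place, at 3 and at 2 -/

/-- No point of the surface `r₁ + r₂ + r₃ = 1 + 2z`, `24 r₁ r₂ r₃ = (1 + 3z)² + 24 z²` has all its
`rᵢ` in the unit interval. -/
theorem not_all_mem_Ioo_of_surface {r₁ r₂ r₃ z : ℝ} (hs : r₁ + r₂ + r₃ = 1 + 2 * z)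
    (hc : 24 * (r₁ * r₂ * r₃) = (1 + 3 * z) ^ 2 + 24 * z ^ 2)
    (h₁ : 0 < r₁ * (1 - r₁)) (h₂ : 0 < r₂ * (1 - r₂)) (h₃ : 0 < r₃ * (1 - r₃)) : False := by
  have key : ∀ r : ℝ, 0 < r * (1 - r) → 0 < r ∧ r < 1 := fun r h => by
    constructor <;> nlinarith [sq_nonneg r, sq_nonneg (1 - r)]
  obtain ⟨a1, b1⟩ := key _ h₁
  obtain ⟨a2, b2⟩ := key _ h₂
  obtain ⟨a3, b3⟩ := key _ h₃
  have hz : z < 1 := by linarith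
  have amgm : 27 * (r₁ * r₂ * r₃) ≤ (r₁ + r₂ + r₃) ^ 3 := by
    nlinarith [mul_nonneg a1.le (sq_nonneg (r₂ - r₃)), mul_nonneg a2.le (sq_nonneg (r₁ - r₃)),
      mul_nonneg a3.le (sq_nonneg (r₁ - r₂)), mul_nonneg a1.le (sq_nonneg (r₁ - r₃)),
      mul_nonneg a1.le (sq_nonneg (r₁ - r₂)), mul_nonneg a2.le (sq_nonneg (r₂ - r₃)),
      mul_nonneg a2.le (sq_nonneg (r₁ - r₂)), mul_nonneg a3.le (sq_nonneg (r₁ - r₃)),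
      mul_nonneg a3.le (sq_nonneg (r₂ - r₃))]
  rw [hs] at amgm
  -- With the cubic relation, AM-GM becomes (1 + 3z)² + 64z²(3 - z) ≤ 0, impossible for z < 1.
  nlinarith [mul_nonneg (sq_nonneg z) (sub_nonneg.mpr hz.le), sq_nonneg (1 + 3 * z)]

/-- An integer that is negative, `2` modulo `3`, a local norm from `ℚ(√-6)` at the primes where `-6`
is a non-residue, is subject to a condition at `2`. -/
theorem false_of_neg_of_mod_three {n : ℤ} (hn : n < 0) (h3 : n % 3 = 2)
    (h2 : n % 8 = 3 ∨ n % 32 = 20)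
    (hv : ∀ p : ℕ, p.Prime → jacobiSym (-6) p = -1 → Even (padicValInt p n)) : False := by
  -- Here m is |n| or |n|/4, prime to 6. By reciprocity (-6/m) depends only on m mod 24, and it is
  -- -1 for the classes 13 and 19.
  have main : ∀ m : ℕ, m % 24 = 13 ∨ m % 24 = 19 →
      (∀ p : ℕ, p.Prime → jacobiSym (-6) p = -1 → Even (padicValNat p m)) → False := by
    intro m hm h
    have hc : IsCoprime (-6 : ℤ) m := by
      rcases hm with hm | hm
      · exact ⟨2 + 4 * (m / 24 : ℕ), 1, by lia⟩
      · exact ⟨3 + 4 * (m / 24 : ℕ), 1, by lia⟩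
    have h1 := jacobiSym_eq_one_of_even_padicValNat (-6) m (by lia) hc h
    rw [jacobiSym.mod_right (-6) (Nat.odd_iff.mpr (by lia))] at h1
    have h24 : m % (4 * (-6 : ℤ).natAbs) = m % 24 := rfl
    rw [h24] at h1
    rcases hm with hm | hm <;> rw [hm] at h1 <;> norm_num at h1
  rcases h2 with h2 | h2
  · refine main n.natAbs (by lia) fun p hp hj => ?_
    exact hv p hp hj
  · obtain ⟨k, hk⟩ : ∃ k : ℕ, n = -(2 * 2 * k) := ⟨(n / 4).natAbs, by lia⟩
    refine main k (by lia) fun p hp hj => ?_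
    have hp2 : p ≠ 2 := by rintro rfl; norm_num at hj
    have hvp := hv p hp hj
    have := Fact.mk hp
    have h22 : padicValNat p 2 = 0 := by
      apply padicValNat.eq_zero_of_not_dvd
      rwa [Nat.prime_dvd_prime_iff_eq hp Nat.prime_two]
    have hk0 : k ≠ 0 := by lia
    rwa [hk, padicValInt, Int.natAbs_neg,
      show ((2 : ℤ) * 2 * (k : ℤ)).natAbs = 2 * 2 * k by rw [Int.natAbs_mul]; rfl,
      padicValNat.mul (by norm_num) hk0, padicValNat.mul (by norm_num) (by norm_num), h22,
      zero_add, zero_add] at hvp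

/-- Squares and nonzero values of a² + 6b² have even valuation at p, so all nᵢ have the same parity
of valuation. -/
theorem even_padicValInt_add_of_sq_mul_eq {p : ℕ} (hp : p.Prime) (hj : jacobiSym (-6) p = -1)
    {a m n d b₁ c₁ b₂ c₂ : ℤ} (ha : a ≠ 0) (hm : m ≠ 0) (hn : n ≠ 0)
    (h : a ^ 2 * (m * n) = d ^ 2 * ((b₁ ^ 2 + 6 * c₁ ^ 2) * (b₂ ^ 2 + 6 * c₂ ^ 2))) :
    Even (padicValInt p m + padicValInt p n) := by
  have := Fact.mk hp
  have hl : a ^ 2 * (m * n) ≠ 0 := mul_ne_zero (pow_ne_zero _ ha) (mul_ne_zero hm hn)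
  have hr := h ▸ hl
  have hd : d ≠ 0 := by rintro rfl; simp at hr
  have h₁ := left_ne_zero_of_mul (right_ne_zero_of_mul hr)
  have h₂ := right_ne_zero_of_mul (right_ne_zero_of_mul hr)
  have hv := congrArg (padicValInt p) h
  rw [pow_two a, pow_two d, padicValInt.mul (mul_ne_zero ha ha) (mul_ne_zero hm hn),
    padicValInt.mul ha ha, padicValInt.mul hm hn, padicValInt.mul (mul_ne_zero hd hd)
    (mul_ne_zero h₁ h₂), padicValInt.mul hd hd, padicValInt.mul h₁ h₂] at hv
  obtain ⟨x, hx⟩ := even_padicValInt_sq_add_six_mul_sq hp hj b₁ c₁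
  obtain ⟨y, hy⟩ := even_padicValInt_sq_add_six_mul_sq hp hj b₂ c₂
  exact ⟨padicValInt p d + x + y - padicValInt p a, by lia⟩

/-! ### The surface in the homogeneous coordinates Rᵢ, D, Z -/

section Surface

variable {R₁ R₂ R₃ D Z : ℤ}

/-- The product of two of the `Rᵢ (D - Rᵢ)` is a norm from `ℚ(√-6)` up to squares. -/
theorem surface_norm_identity (hs : R₁ + R₂ + R₃ = D + 2 * Z)
    (hc : 24 * (R₁ * R₂ * R₃) = D * ((D + 3 * Z) ^ 2 + 24 * Z ^ 2)) :
    (24 * R₁) ^ 2 * ((R₂ * (D - R₂)) * (R₃ * (D - R₃))) =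
      D ^ 2 * (((D + 3 * Z) ^ 2 + 6 * (2 * Z) ^ 2) *
        ((D + 3 * Z) ^ 2 + 6 * (2 * R₁ - 2 * Z) ^ 2)) := by
  have h2 : 24 * (R₁ * (D - R₂) * (D - R₃)) =
      D * ((D + 3 * Z) ^ 2 + 6 * (2 * R₁ - 2 * Z) ^ 2) := by
    linear_combination hc - 24 * R₁ * D * hs
  calc _ = (24 * (R₁ * R₂ * R₃)) * (24 * (R₁ * (D - R₂) * (D - R₃))) := by ring
    _ = _ := by rw [hc, h2]; ring

theorem Int.even_padicValInt_mul_sub_of_not_dvd {p : ℕ} {R D : ℤ} (hp : p.Prime)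
    (hD : (p : ℤ) ∣ D) (hR : ¬ (p : ℤ) ∣ R) : Even (padicValInt p (R * (D - R))) := by
  rw [padicValInt.eq_zero_of_not_dvd]
  · exact Even.zero
  · intro h
    rcases (Nat.prime_iff_prime_int.mp hp).dvd_or_dvd h with h | h
    · exact hR h
    · exact hR ((dvd_sub_right hD).mp h)

theorem exists_even_padicValInt_of_surface {p : ℕ} (hp : p.Prime) (hj : jacobiSym (-6) p = -1)
    (hs : R₁ + R₂ + R₃ = D + 2 * Z)
    (hc : 24 * (R₁ * R₂ * R₃) = D * ((D + 3 * Z) ^ 2 + 24 * Z ^ 2))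
    (hprim : ¬ ((p : ℤ) ∣ R₁ ∧ (p : ℤ) ∣ R₂ ∧ (p : ℤ) ∣ R₃ ∧ (p : ℤ) ∣ D)) :
    Even (padicValInt p (R₁ * (D - R₁))) ∨ Even (padicValInt p (R₂ * (D - R₂))) ∨
      Even (padicValInt p (R₃ * (D - R₃))) := by
  have hpi := Nat.prime_iff_prime_int.mp hp
  have hp2 : p ≠ 2 := by rintro rfl; norm_num at hj
  have h2 : ¬ (p : ℤ) ∣ 2 := by
    intro h
    exact hp2 ((Nat.prime_dvd_prime_iff_eq hp Nat.prime_two).mp (by exact_mod_cast h))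
  by_cases hD : (p : ℤ) ∣ D
  · by_cases h₁ : (p : ℤ) ∣ R₁
    · by_cases h₂ : (p : ℤ) ∣ R₂
      · exact .inr (.inr (Int.even_padicValInt_mul_sub_of_not_dvd hp hD fun h₃ =>
          hprim ⟨h₁, h₂, h₃, hD⟩))
      · exact .inr (.inl (Int.even_padicValInt_mul_sub_of_not_dvd hp hD h₂))
    · exact .inl (Int.even_padicValInt_mul_sub_of_not_dvd hp hD h₁)
  -- If p divided some Rᵢ it would divide the norm factor, hence D + 3Z and 2Z, hence D.
  have hnot : ∀ x y z : ℤ, 24 * (x * y * z) = D * ((D + 3 * Z) ^ 2 + 24 * Z ^ 2) →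
      ¬ (p : ℤ) ∣ x := by
    intro x y z h hx
    have h1 : (p : ℤ) ∣ D * ((D + 3 * Z) ^ 2 + 6 * (2 * Z) ^ 2) := by
      rw [show D * ((D + 3 * Z) ^ 2 + 6 * (2 * Z) ^ 2) = x * (24 * (y * z)) by
        linear_combination -h]
      exact hx.mul_right _
    obtain ⟨ha, hb⟩ :=
      dvd_and_dvd_of_dvd_sq_add_six_mul_sq hp hj ((hpi.dvd_or_dvd h1).resolve_left hD)
    have hZ := (hpi.dvd_or_dvd hb).resolve_left h2
    exact hD ((dvd_add_left (hZ.mul_left 3)).mp ha)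
  have key : ∀ x : ℤ, ¬ (p : ℤ) ∣ x → ¬ Even (padicValInt p (x * (D - x))) →
      (p : ℤ) ∣ D - x := by
    intro x hx hodd
    by_contra h
    apply hodd
    rw [padicValInt.eq_zero_of_not_dvd fun h' => (hpi.dvd_or_dvd h').elim hx h]
    exact Even.zero
  by_contra! hcon
  have e₁ := key R₁ (hnot R₁ R₂ R₃ hc) hcon.1
  have e₂ := key R₂ (hnot R₂ R₁ R₃ (by linarith)) hcon.2.1
  have e₃ := key R₃ (hnot R₃ R₂ R₁ (by linarith)) hcon.2.2
  -- If every Rᵢ ≡ D, the linear relation gives 2Z ≡ 2D and the cubic one 24D³ ≡ 40D³; an extra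
  -- factor 4 avoids dividing by 2.
  have hdvd : (p : ℤ) ∣ 2 ^ 6 * D ^ 3 := by
    have hs' := congrArg (Int.cast : ℤ → ZMod p) hs
    have hc' := congrArg (Int.cast : ℤ → ZMod p) hc
    rw [← ZMod.intCast_zmod_eq_zero_iff_dvd] at e₁ e₂ e₃ ⊢
    push_cast at hs' hc' e₁ e₂ e₃ ⊢
    rw [← sub_eq_zero.mp e₁, ← sub_eq_zero.mp e₂, ← sub_eq_zero.mp e₃] at hs' hc'
    linear_combination (D : ZMod p) * (66 * (Z : ZMod p) + 78 * D) * hs' - 4 * hc'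
  rcases hpi.dvd_or_dvd hdvd with h | h
  · exact h2 (hpi.dvd_of_dvd_pow h)
  · exact hD (hpi.dvd_of_dvd_pow h)

/-- The cubic relation gives 3 ∣ D, so nᵢ ≡ -Rᵢ² modulo 3, and primitivity provides an Rᵢ prime to
3. -/
theorem exists_mod_three_eq_two_of_surface (hs : R₁ + R₂ + R₃ = D + 2 * Z)
    (hc : 24 * (R₁ * R₂ * R₃) = D * ((D + 3 * Z) ^ 2 + 24 * Z ^ 2))
    (hprim : ¬ (3 ∣ R₁ ∧ 3 ∣ R₂ ∧ 3 ∣ R₃ ∧ 3 ∣ D)) :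
    R₁ * (D - R₁) % 3 = 2 ∨ R₂ * (D - R₂) % 3 = 2 ∨ R₃ * (D - R₃) % 3 = 2 := by
  have hD : (3 : ℤ) ∣ D := by
    have : (3 : ℤ) ∣ D ^ 3 := ⟨8 * (R₁ * R₂ * R₃) - D * (2 * D * Z + 11 * Z ^ 2), by
      linear_combination -hc⟩
    exact Int.prime_three.dvd_of_dvd_pow this
  obtain ⟨d, rfl⟩ := hD
  have key : ∀ x : ℤ, ¬ 3 ∣ x → x * (3 * d - x) % 3 = 2 := by
    intro x hx
    have h : x % 3 = 1 ∨ x % 3 = 2 := by lia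
    have h2 : x * x % 3 = 1 := by rcases h with h | h <;> rw [Int.mul_emod, h] <;> rfl
    have h3 : x * (3 * d - x) = 3 * (x * d) - x * x := by ring
    lia
  by_cases h₁ : 3 ∣ R₁
  · by_cases h₂ : 3 ∣ R₂
    · exact .inr (.inr (key _ fun h₃ => hprim ⟨h₁, h₂, h₃, dvd_mul_right _ _⟩))
    · exact .inr (.inl (key _ h₂))
  · exact .inl (key _ h₁)

theorem exists_nonpos_of_surface (hD : D ≠ 0) (hs : R₁ + R₂ + R₃ = D + 2 * Z)
    (hc : 24 * (R₁ * R₂ * R₃) = D * ((D + 3 * Z) ^ 2 + 24 * Z ^ 2)) :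
    R₁ * (D - R₁) ≤ 0 ∨ R₂ * (D - R₂) ≤ 0 ∨ R₃ * (D - R₃) ≤ 0 := by
  by_contra! h
  have hD' : (D : ℝ) ≠ 0 := by exact_mod_cast hD
  have hs' : (R₁ + R₂ + R₃ : ℝ) = D + 2 * Z := by exact_mod_cast hs
  have hc' : (24 * (R₁ * R₂ * R₃) : ℝ) = D * ((D + 3 * Z) ^ 2 + 24 * Z ^ 2) := by
    exact_mod_cast hc
  have key : ∀ R : ℤ, 0 < R * (D - R) → (0 : ℝ) < R / D * (1 - R / D) := by
    intro R hR
    have : (0 : ℝ) < R * (D - R) := by exact_mod_cast hR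
    rw [show (R : ℝ) / D * (1 - R / D) = R * (D - R) / D ^ 2 by field_simp]
    positivity
  refine not_all_mem_Ioo_of_surface (z := Z / D) ?_ ?_ (key _ h.1) (key _ h.2.1) (key _ h.2.2)
  · field_simp; linarith
  · field_simp; linarith

/-- The norm identity spreads negativity and even valuations from one nᵢ to all three; reciprocity
is then applied to the nᵢ that is 2 modulo 3. -/
theorem false_of_primitive_surface (hs : R₁ + R₂ + R₃ = D + 2 * Z)
    (hc : 24 * (R₁ * R₂ * R₃) = D * ((D + 3 * Z) ^ 2 + 24 * Z ^ 2))
    (hprim : ∀ p : ℕ, p.Prime → p ≠ 2 →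
      ¬ ((p : ℤ) ∣ R₁ ∧ (p : ℤ) ∣ R₂ ∧ (p : ℤ) ∣ R₃ ∧ (p : ℤ) ∣ D))
    (h₁ : R₁ * (D - R₁) % 8 = 3) (h₂ : R₂ * (D - R₂) % 8 = 3) (h₃ : R₃ * (D - R₃) % 32 = 20) :
    False := by
  have n₁ : R₁ * (D - R₁) ≠ 0 := by intro h; simp [h] at h₁
  have n₂ : R₂ * (D - R₂) ≠ 0 := by intro h; simp [h] at h₂
  have n₃ : R₃ * (D - R₃) ≠ 0 := by intro h; simp [h] at h₃
  have r₁ := left_ne_zero_of_mul n₁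
  have r₂ := left_ne_zero_of_mul n₂
  have r₃ := left_ne_zero_of_mul n₃
  have hD : D ≠ 0 := by
    rintro rfl
    simp [r₁, r₂, r₃] at hc
  have i₁ := surface_norm_identity hs hc
  have i₂ := surface_norm_identity (R₁ := R₂) (R₂ := R₁) (R₃ := R₃) (by linarith)
    (by linarith : 24 * (R₂ * R₁ * R₃) = D * ((D + 3 * Z) ^ 2 + 24 * Z ^ 2))
  have hneg : R₁ * (D - R₁) < 0 ∧ R₂ * (D - R₂) < 0 ∧ R₃ * (D - R₃) < 0 := by
    have hpos : ∀ {a m n d b c : ℤ}, a ≠ 0 → m ≠ 0 → n ≠ 0 →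
        a ^ 2 * (m * n) = d ^ 2 * ((b ^ 2 + 6 * (2 * Z) ^ 2) * (b ^ 2 + 6 * c ^ 2)) →
        (m < 0 ↔ n < 0) := by
      intro a m n d b c ha hm hn h
      have h1 : 0 ≤ a ^ 2 * (m * n) := h ▸ by positivity
      have h2 : 0 ≤ m * n := nonneg_of_mul_nonneg_right h1 (by positivity)
      rcases lt_or_gt_of_ne hm with hm | hm <;> rcases lt_or_gt_of_ne hn with hn | hn
      · simp [hm, hn]
      · nlinarith
      · nlinarith
      · simp [hm.not_gt, hn.not_gt]
    have e₁ := hpos (by simpa using r₁) n₂ n₃ i₁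
    have e₂ := hpos (by simpa using r₂) n₁ n₃ i₂
    have := exists_nonpos_of_surface hD hs hc
    lia
  have hev : ∀ p : ℕ, p.Prime → jacobiSym (-6) p = -1 → Even (padicValInt p (R₁ * (D - R₁))) ∧
      Even (padicValInt p (R₂ * (D - R₂))) ∧ Even (padicValInt p (R₃ * (D - R₃))) := by
    intro p hp hj
    have hp2 : p ≠ 2 := by rintro rfl; norm_num at hj
    have e₁ := even_padicValInt_add_of_sq_mul_eq hp hj (by simpa using r₁) n₂ n₃ i₁
    have e₂ := even_padicValInt_add_of_sq_mul_eq hp hj (by simpa using r₂) n₁ n₃ i₂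
    have := exists_even_padicValInt_of_surface hp hj hs hc (hprim p hp hp2)
    rw [Nat.even_add] at e₁ e₂
    tauto
  rcases exists_mod_three_eq_two_of_surface hs hc (by exact_mod_cast hprim 3 Nat.prime_three (by norm_num))
    with h | h | h
  · exact false_of_neg_of_mod_three hneg.1 h (.inl h₁) fun p hp hj => (hev p hp hj).1
  · exact false_of_neg_of_mod_three hneg.2.1 h (.inl h₂) fun p hp hj => (hev p hp hj).2.1
  · exact false_of_neg_of_mod_three hneg.2.2 h (.inr h₃) fun p hp hj => (hev p hp hj).2.2

/-- Primitivity at odd primes is reached by descent on |R₁|: dividing by an odd p divides each nᵢ by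
p² ≡ 1 mod 8, which preserves the 2-adic conditions. -/
theorem false_of_surface (hs : R₁ + R₂ + R₃ = D + 2 * Z)
    (hc : 24 * (R₁ * R₂ * R₃) = D * ((D + 3 * Z) ^ 2 + 24 * Z ^ 2))
    (h₁ : R₁ * (D - R₁) % 8 = 3) (h₂ : R₂ * (D - R₂) % 8 = 3) (h₃ : R₃ * (D - R₃) % 32 = 20) :
    False := by
  induction hn : R₁.natAbs using Nat.strong_induction_on generalizing R₁ R₂ R₃ D Z with
  | _ n ih =>
  refine false_of_primitive_surface hs hc ?_ h₁ h₂ h₃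
  rintro p hp hp2 ⟨⟨a, rfl⟩, ⟨b, rfl⟩, ⟨c, rfl⟩, ⟨d, rfl⟩⟩
  have hpi := Nat.prime_iff_prime_int.mp hp
  have hZ : (p : ℤ) ∣ 2 * Z := ⟨a + b + c - d, by linear_combination -hs⟩
  have hp2' : ¬ (p : ℤ) ∣ 2 := fun h =>
    hp2 ((Nat.prime_dvd_prime_iff_eq hp Nat.prime_two).mp (by exact_mod_cast h))
  obtain ⟨z, rfl⟩ := (hpi.dvd_or_dvd hZ).resolve_left hp2'
  have hp0 : (p : ℤ) ≠ 0 := hpi.ne_zero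
  obtain ⟨k, hk⟩ : ∃ k : ℤ, (p : ℤ) ^ 2 = 8 * k + 1 := by
    obtain ⟨j, hj⟩ := hp.odd_of_ne_two hp2
    obtain ⟨t, ht⟩ := Nat.even_mul_succ_self j
    refine ⟨t, ?_⟩
    rw [hj]
    push_cast
    have : (j * (j + 1) : ℤ) = t + t := by exact_mod_cast ht
    linear_combination 4 * this
  have red : ∀ x y : ℤ, p * x * (p * y - p * x) = 8 * (k * (x * (y - x))) + x * (y - x) := by
    intro x y
    linear_combination (x * (y - x)) * hk
  rw [red] at h₁ h₂ h₃
  have ha : a ≠ 0 := by rintro rfl; simp at h₁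
  refine ih a.natAbs ?_ (R₁ := a) (R₂ := b) (R₃ := c) (D := d) (Z := z) ?_ ?_ (by lia) (by lia)
    ?_ rfl
  · rw [← hn, Int.natAbs_mul, Int.natAbs_natCast]
    have : 0 < a.natAbs := Int.natAbs_pos.mpr ha
    nlinarith [hp.one_lt]
  · exact mul_left_cancel₀ hp0 (by linear_combination hs)
  · exact mul_left_cancel₀ (pow_ne_zero 3 hp0) (by linear_combination hc)
  · obtain ⟨w, hw⟩ : ∃ w, c * (d - c) = 4 * w := ⟨c * (d - c) / 4, by lia⟩
    rw [hw] at h₃ ⊢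
    have : 8 * (k * (4 * w)) = 32 * (k * w) := by ring
    lia

end Surface

/-! ### The 2-adic ball around (1, 1, 22) -/

/-- Norms are powers of 2, so a norm below 1/16 means divisibility by 32. An even denominator would
make the numerator even too, against lowest terms. -/
theorem Padic.exists_odd_den_of_norm_sub_lt {q : ℚ} {c : ℤ} (h : ‖(q : ℚ_[2]) - c‖ < 1 / 16) :
    ∃ t : ℤ, q.num = c * q.den + 32 * t ∧ Odd (q.den : ℤ) := by
  have h1 : ‖((q.num - c * q.den : ℤ) : ℚ_[2])‖ < 1 / 16 := by
    have hd : (q.den : ℚ_[2]) ≠ 0 := by exact_mod_cast q.den_nz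
    have he : ((q.num - c * q.den : ℤ) : ℚ_[2]) = (q - c) * (q.den : ℤ) := by
      push_cast
      rw [sub_mul, ← Rat.cast_natCast, ← Rat.cast_mul, Rat.mul_den_eq_num, Rat.cast_intCast]
    rw [he, norm_mul]
    have := Padic.norm_int_le_one (p := 2) q.den
    nlinarith [norm_nonneg ((q : ℚ_[2]) - c)]
  have h2 : ((2 ^ 5 : ℕ) : ℤ) ∣ q.num - c * q.den := by
    have := (Padic.norm_int_le_pow_iff_dvd (p := 2) (q.num - c * q.den) 5).mp ?_
    · exact_mod_cast this
    · rw [Padic.norm_le_pow_iff_norm_lt_pow_add_one]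
      norm_num at h1 ⊢
      exact h1
  obtain ⟨t, ht⟩ := h2
  refine ⟨t, by push_cast at ht; linarith, ?_⟩
  rw [← Int.not_even_iff_odd]
  intro hev
  have hnum : (2 : ℤ) ∣ q.num := by
    have : q.num = c * q.den + 2 * (16 * t) := by push_cast at ht; linarith
    rw [this]
    exact dvd_add (hev.two_dvd.mul_left c) (dvd_mul_right _ _)
  have h3 := Nat.dvd_gcd (Int.natAbs_dvd_natAbs.mpr hnum) (Int.natCast_dvd_natCast.mp hev.two_dvd)
  rw [q.reduced] at h3
  norm_num at h3

theorem mem_zeroLocus_surfaceU50 {K : Type*} [Field K] [Algebra ℚ K] (x : Fin 3 → K) :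
    x ∈ MvPolynomial.zeroLocus K surfaceU50 ↔
      x 0 ^ 3 + x 1 ^ 3 + x 2 ^ 3 + 21 * (x 0 + x 1 + x 2) - 50 = 0 := by
  rw [surfaceU50, MvPolynomial.zeroLocus_span]
  simp

/-- The surface has no rational point in the ball of radius `1 / 16` around `(1, 1, 22)` in `ℚ₂³`. -/
theorem not_norm_sub_lt_of_rat_surface {x y z : ℚ}
    (h : x ^ 3 + y ^ 3 + z ^ 3 + 21 * (x + y + z) - 50 = 0)
    (hx : ‖(x : ℚ_[2]) - (1 : ℤ)‖ < 1 / 16) (hy : ‖(y : ℚ_[2]) - (1 : ℤ)‖ < 1 / 16)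
    (hz : ‖(z : ℚ_[2]) - (22 : ℤ)‖ < 1 / 16) : False := by
  obtain ⟨t₁, e₁, o₁⟩ := Padic.exists_odd_den_of_norm_sub_lt hx
  obtain ⟨t₂, e₂, o₂⟩ := Padic.exists_odd_den_of_norm_sub_lt hy
  obtain ⟨t₃, e₃, o₃⟩ := Padic.exists_odd_den_of_norm_sub_lt hz
  obtain ⟨a, ha⟩ : ∃ a : ℤ, a = x.den := ⟨_, rfl⟩
  obtain ⟨b, hb⟩ : ∃ b : ℤ, b = y.den := ⟨_, rfl⟩
  obtain ⟨c, hc⟩ : ∃ c : ℤ, c = z.den := ⟨_, rfl⟩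
  have hx' : x * a = 1 * a + 32 * t₁ := by
    rw [ha, Int.cast_natCast, Rat.mul_den_eq_num, e₁]; push_cast; rfl
  have hy' : y * b = 1 * b + 32 * t₂ := by
    rw [hb, Int.cast_natCast, Rat.mul_den_eq_num, e₂]; push_cast; rfl
  have hz' : z * c = 22 * c + 32 * t₃ := by
    rw [hc, Int.cast_natCast, Rat.mul_den_eq_num, e₃]; push_cast; rfl
  rw [← ha] at o₁
  rw [← hb] at o₂
  rw [← hc] at o₃
  obtain ⟨e, he⟩ : ∃ e : ℤ, e = a * b * c := ⟨_, rfl⟩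
  obtain ⟨X, hX⟩ : ∃ X : ℤ, X = e + 32 * (t₁ * b * c) := ⟨_, rfl⟩
  obtain ⟨Y, hY⟩ : ∃ Y : ℤ, Y = e + 32 * (t₂ * a * c) := ⟨_, rfl⟩
  obtain ⟨W, hW⟩ : ∃ W : ℤ, W = 22 * e + 32 * (t₃ * a * b) := ⟨_, rfl⟩
  have xX : x * e = X := by rw [hX, he]; push_cast; linear_combination (b * c : ℚ) * hx'
  have yY : y * e = Y := by rw [hY, he]; push_cast; linear_combination (a * c : ℚ) * hy'
  have zW : z * e = W := by rw [hW, he]; push_cast; linear_combination (a * b : ℚ) * hz'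
  have heq : X ^ 3 + Y ^ 3 + W ^ 3 + 21 * e ^ 2 * (X + Y + W) - 50 * e ^ 3 = 0 := by
    have : (X ^ 3 + Y ^ 3 + W ^ 3 + 21 * e ^ 2 * (X + Y + W) - 50 * e ^ 3 : ℚ) = 0 := by
      rw [← xX, ← yY, ← zW]
      linear_combination (e : ℚ) ^ 3 * h
    exact_mod_cast this
  obtain ⟨k, hk⟩ : ∃ k : ℤ, e * e = 8 * k + 1 := by
    obtain ⟨j, hj⟩ := he ▸ (o₁.mul o₂).mul o₃
    obtain ⟨t, ht⟩ := Int.even_mul_succ_self j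
    exact ⟨t, by rw [hj]; linear_combination 4 * ht⟩
  obtain ⟨u₁, hu₁⟩ : ∃ u, u = t₁ * b * c := ⟨_, rfl⟩
  obtain ⟨u₂, hu₂⟩ : ∃ u, u = t₂ * a * c := ⟨_, rfl⟩
  obtain ⟨u₃, hu₃⟩ : ∃ u, u = t₃ * a * b := ⟨_, rfl⟩
  rw [← hu₁] at hX
  rw [← hu₂] at hY
  rw [← hu₃] at hW
  -- At the centre, in units of e, the Rᵢ are 23, 23, 2 and D = 44, so the nᵢ are 483, 483, 84: 3
  -- mod 8 twice and 20 mod 32. The factor e² ≡ 1 mod 8 does not change this.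
  refine false_of_surface (R₁ := Y + W) (R₂ := X + W) (R₃ := X + Y) (D := 2 * (X + Y + W - 2 * e))
    (Z := 2 * e) (by ring) (by linear_combination (-8) * heq) ?_ ?_ ?_
  · have : (Y + W) * (2 * (X + Y + W - 2 * e) - (Y + W)) = 8 * (60 * (8 * k + 1) + 4 * (
        23 * e * (2 * u₁ + u₂ + u₃) + (u₂ + u₃) * (21 * e + 32 * (2 * u₁ + u₂ + u₃)))) +
        3 * (8 * k + 1) := by
      rw [hX, hY, hW, ← hk]; ring
    lia
  · have : (X + W) * (2 * (X + Y + W - 2 * e) - (X + W)) = 8 * (60 * (8 * k + 1) + 4 * (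
        23 * e * (u₁ + 2 * u₂ + u₃) + (u₁ + u₃) * (21 * e + 32 * (u₁ + 2 * u₂ + u₃)))) +
        3 * (8 * k + 1) := by
      rw [hX, hY, hW, ← hk]; ring
    lia
  · have : (X + Y) * (2 * (X + Y + W - 2 * e) - (X + Y)) = 32 * (
        2 * e * (u₁ + u₂ + 2 * u₃) + (u₁ + u₂) * (42 * e + 32 * (u₁ + u₂ + 2 * u₃))) +
        84 * (8 * k + 1) := by
      rw [hX, hY, hW, ← hk]; ring
    lia

/-- The ball of radius `1 / 16` around `(1, 1, 22)` in `ℚ₂³` contains a point of the surface. -/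
theorem exists_padic_surface_point : ∃ z : ℚ_[2],
    (1 : ℚ_[2]) ^ 3 + 1 ^ 3 + z ^ 3 + 21 * (1 + 1 + z) - 50 = 0 ∧ ‖z - (22 : ℤ)‖ < 1 / 16 := by
  -- The surface equation on the line x₁ = x₂ = 1. Here F(22) = 11104 = 32 · 347 and F'(22) = 1473
  -- is odd.
  let F : Polynomial ℤ := Polynomial.X ^ 3 + 21 * Polynomial.X - 6
  have hF : ∀ z : ℤ_[2], F.aeval z = z ^ 3 + 21 * z - 6 := fun z => by simp [F, map_ofNat]
  have hF' : ∀ z : ℤ_[2], F.derivative.aeval z = 3 * z ^ 2 + 21 := fun z => by simp [F, map_ofNat]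
  have hd : ‖F.derivative.aeval (22 : ℤ_[2])‖ = 1 := by
    rw [hF', show (3 * 22 ^ 2 + 21 : ℤ_[2]) = ((1473 : ℤ) : ℤ_[2]) by norm_num,
      PadicInt.norm_intCast_eq_one_iff]
    exact ⟨1, -736, by norm_num⟩
  have hn : ‖(11104 : ℤ_[2])‖ ≤ 1 / 32 := by
    have := (PadicInt.norm_int_le_pow_iff_dvd (p := 2) (k := 11104) (n := 5)).mpr (by norm_num)
    norm_num at this ⊢
    exact this
  obtain ⟨z, hz, hzn, -⟩ := hensels_lemma (p := 2) (F := F) (a := 22) (by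
    rw [hd, hF, show (22 ^ 3 + 21 * 22 - 6 : ℤ_[2]) = 11104 by norm_num]
    linarith)
  rw [hd] at hzn
  rw [hF] at hz
  refine ⟨z, ?_, ?_⟩
  · have h0 := congrArg (PadicInt.Coe.ringHom (p := 2)) hz
    simp only [map_sub, map_add, map_mul, map_pow, map_ofNat, map_zero] at h0
    change (z : ℚ_[2]) ^ 3 + 21 * z - 6 = 0 at h0
    linear_combination h0
  · have h1 : (z - 22) * ((z - 22) * (z + 44) + 1473) = -11104 := by linear_combination hz
    have h2 : ‖(z - 22) * (z + 44) + 1473‖ = 1 := by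
      have h3 : ‖(1473 : ℤ_[2])‖ = 1 := by
        have := (PadicInt.norm_intCast_eq_one_iff (p := 2) (z := 1473)).mpr ⟨1, -736, by norm_num⟩
        exact_mod_cast this
      have h4 : ‖(z - 22) * (z + 44)‖ < 1 := by
        rw [norm_mul]
        nlinarith [PadicInt.norm_le_one (z + 44), norm_nonneg (z - 22)]
      rw [PadicInt.norm_add_eq_max_of_ne (by rw [h3]; exact h4.ne), h3, max_eq_right h4.le]
    have h3 : ‖z - 22‖ ≤ 1 / 32 := by
      have := congrArg norm h1
      rw [norm_mul, h2, mul_one, norm_neg] at this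
      rw [this]; exact hn
    have h4 : ‖(z : ℚ_[2]) - (22 : ℤ)‖ = ‖z - 22‖ := by
      rw [PadicInt.norm_def]; push_cast; rfl
    rw [h4]; linarith

/-! ### Quaternion algebras over ℝ -/

theorem realInvariant_of_pos {a b : ℝ} (ha : 0 < a) (hb : b ≠ 0) : realInvariant a b = 0 := by
  refine if_pos ?_
  have hs : √a * √a = a := Real.mul_self_sqrt ha.le
  have hs0 : √a ≠ 0 := (Real.sqrt_pos.mpr ha).ne'
  let B : QuaternionAlgebra.Basis (Matrix (Fin 2) (Fin 2) ℝ) a 0 b :=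
    { i := !![√a, 0; 0, -√a]
      j := !![0, b; 1, 0]
      k := !![0, √a * b; -√a, 0]
      i_mul_i := by ext i j; fin_cases i <;> fin_cases j <;> simp [hs]
      j_mul_j := by ext i j; fin_cases i <;> fin_cases j <;> simp
      i_mul_j := by ext i j; fin_cases i <;> fin_cases j <;> simp
      j_mul_i := by ext i j; fin_cases i <;> fin_cases j <;> simp [mul_comm] }
  -- Both algebras have dimension 4, so injectivity suffices.
  have hinj : Function.Injective B.liftHom := by
    rw [injective_iff_map_eq_zero]
    intro q hq
    have h00 := congrFun (congrFun hq 0) 0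
    have h01 := congrFun (congrFun hq 0) 1
    have h10 := congrFun (congrFun hq 1) 0
    have h11 := congrFun (congrFun hq 1) 1
    simp [B, QuaternionAlgebra.Basis.lift, Algebra.algebraMap_eq_smul_one] at h00 h01 h10 h11
    have hi : q.imI = 0 := by
      have : q.imI * √a = 0 := by linarith
      simpa [hs0] using this
    have hk : q.imK = 0 := by
      have : q.imK * √a * b = 0 := by linear_combination (h01 - b * h10) / 2
      simpa [hs0, hb] using this
    ext
    · simpa [hi] using h00
    · exact hi
    · simpa [hk] using h10
    · exact hk
  have hfin : Module.finrank ℝ ℍ[ℝ, a, b] = Module.finrank ℝ (Matrix (Fin 2) (Fin 2) ℝ) := by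
    rw [QuaternionAlgebra.finrank_eq_four, Module.finrank_matrix]; simp
  exact ⟨AlgEquiv.ofBijective B.liftHom ⟨hinj,
    (LinearMap.injective_iff_surjective_of_finrank_eq_finrank
      (f := B.liftHom.toLinearMap) hfin).mp hinj⟩⟩

/-- A splitting would carry a nonzero nilpotent matrix to some q ≠ 0 with q² = 0, but the norm form
r² - ai² - bj² + abk² is positive definite. -/
theorem realInvariant_of_neg {a b : ℝ} (ha : a < 0) (hb : b < 0) :
    realInvariant a b = ((1 / 2 : ℚ) : AddCircle (1 : ℚ)) := by
  refine if_neg ?_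
  rintro ⟨e⟩
  let m : Matrix (Fin 2) (Fin 2) ℝ := !![0, 1; 0, 0]
  have hm : m ≠ 0 := fun h => by simpa [m] using congrFun (congrFun h 0) 1
  have hmm : m * m = 0 := by ext i j; fin_cases i <;> fin_cases j <;> simp [m]
  obtain ⟨q, hq⟩ : ∃ q, q = e.symm m := ⟨_, rfl⟩
  have hq0 : q ≠ 0 := by rw [hq]; simpa using hm
  have hqq : q * q = 0 := by rw [hq, ← map_mul, hmm, map_zero]
  apply hq0
  have hr := congrArg QuaternionAlgebra.re hqq
  have hi := congrArg QuaternionAlgebra.imI hqq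
  have hj := congrArg QuaternionAlgebra.imJ hqq
  have hk := congrArg QuaternionAlgebra.imK hqq
  simp at hr hi hj hk
  obtain ⟨r, i, j, k⟩ := q
  simp only at hr hi hj hk
  have hab : 0 < a * b := mul_pos_of_neg_of_neg ha hb
  have hr0 : r = 0 := by
    by_contra h
    have hi0 : i = 0 := by
      have : r * i = 0 := by linarith
      simpa [h] using this
    have hj0 : j = 0 := by
      have : r * j = 0 := by linarith
      simpa [h] using this
    have hk0 : k = 0 := by
      have : r * k = 0 := by linarith
      simpa [h] using this
    subst hi0 hj0 hk0
    simp at hr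
    exact h hr
  have hsum : -a * i ^ 2 + -b * j ^ 2 + a * b * k ^ 2 = 0 := by rw [hr0] at hr; linarith
  have hi1 := mul_nonneg (neg_pos.mpr ha).le (sq_nonneg i)
  have hj1 := mul_nonneg (neg_pos.mpr hb).le (sq_nonneg j)
  have hk1 := mul_nonneg hab.le (sq_nonneg k)
  have hi0 : -a * i ^ 2 = 0 := by linarith
  have hj0 : -b * j ^ 2 = 0 := by linarith
  have hk0 : a * b * k ^ 2 = 0 := by linarith
  have := ha.ne
  have := hb.ne
  ext <;> simp_all

/-! ### From approximation to density at one place; the theorem -/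

/-- If `U(ℚ)` is not empty, weak approximation implies density in every single `U(ℚ_v)`. -/
theorem SatisfiesWeakApproximation.denseRange_ratToLocal {σ : Type} {I : Ideal (MvPolynomial σ ℚ)}
    [Nonempty (MvPolynomial.zeroLocus ℚ I)] (h : SatisfiesWeakApproximation I) (v : RatPlace) :
    DenseRange (ratToLocal I v) := by
  obtain ⟨x⟩ := ‹Nonempty (MvPolynomial.zeroLocus ℚ I)›
  have : ∀ v : RatPlace, Nonempty (MvPolynomial.zeroLocus v.Completion I) := fun v =>
    ⟨ratToLocal I v x⟩
  exact (Function.surjective_eval v).denseRange.comp h (continuous_apply v)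

/-- If `U(ℚ)` is not empty, strong approximation off `S` implies density in `U(ℚ_v)` for every
`v` outside `S`. -/
theorem SatisfiesStrongApproximationOff.denseRange_ratToLocal {σ : Type} [Finite σ]
    {I : Ideal (MvPolynomial σ ℚ)} [Nonempty (MvPolynomial.zeroLocus ℚ I)] {S : Finset RatPlace}
    (h : SatisfiesStrongApproximationOff I S) {v : RatPlace} (hv : v ∉ S) :
    DenseRange (ratToLocal I v) := by
  classical
  obtain ⟨x⟩ := ‹Nonempty (MvPolynomial.zeroLocus ℚ I)›
  have hsurj : Function.Surjective fun y : AdelicPointsOff I S => y ⟨v, hv⟩ := by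
    intro P
    -- Replacing one component of a diagonal adelic point keeps it integral at almost all places.
    refine ⟨⟨Function.update (diagonal I S x) ⟨v, hv⟩ P, ?_⟩, Function.update_self _ _ _⟩
    have h1 := (diagonal I S x).2
    rw [Filter.eventually_cofinite] at h1 ⊢
    refine (h1.insert ⟨v, hv⟩).subset fun w hw => ?_
    by_cases hwv : w = ⟨v, hv⟩
    · exact .inl hwv
    · refine .inr ?_
      rw [Set.mem_ofPred_eq, Function.update_of_ne hwv] at hw
      exact hw
  exact hsurj.denseRange.comp h (RestrictedProduct.continuous_eval _)

theorem not_denseRange_ratToLocal_surfaceU50_two :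
    ¬ DenseRange (ratToLocal surfaceU50 (RatPlace.finite 2)) := by
  intro h
  let c : Fin 3 → ℚ_[2] := ![(1 : ℤ), (1 : ℤ), (22 : ℤ)]
  let W : Set (MvPolynomial.zeroLocus (RatPlace.finite 2).Completion surfaceU50) :=
    {x | ∀ i, ‖x.1 i - (show (RatPlace.finite 2).Completion from c i)‖ < 1 / 16}
  have hW : IsOpen W := by
    have : W = ⋂ i, {x | ‖x.1 i - (show (RatPlace.finite 2).Completion from c i)‖ < 1 / 16} := by
      ext x; simp [W]
    rw [this]
    refine isOpen_iInter_of_finite fun i => isOpen_lt ?_ continuous_const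
    exact (((continuous_apply i).comp continuous_subtype_val).sub continuous_const).norm
  obtain ⟨z, hz, hzn⟩ := exists_padic_surface_point
  let P : Fin 3 → ℚ_[2] := ![1, 1, z]
  have hP : P ∈ MvPolynomial.zeroLocus ℚ_[2] surfaceU50 :=
    (mem_zeroLocus_surfaceU50 P).mpr hz
  have hPW : (⟨P, hP⟩ : MvPolynomial.zeroLocus ℚ_[2] surfaceU50) ∈ W := by
    intro i
    change ‖P i - c i‖ < 1 / 16
    fin_cases i
    · simp [P, c]
    · simp [P, c]
    · exact hzn
  obtain ⟨x, hx⟩ := h.exists_mem_open hW ⟨_, hPW⟩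
  have key : ∀ i, ‖((x.1 i : ℚ) : ℚ_[2]) - c i‖ < 1 / 16 := by
    intro i
    have := hx i
    change ‖algebraMap ℚ ℚ_[2] (x.1 i) - c i‖ < 1 / 16 at this
    rwa [eq_ratCast] at this
  exact not_norm_sub_lt_of_rat_surface ((mem_zeroLocus_surfaceU50 x.1).mp x.2) (key 0) (key 1)
    (key 2)

instance : Nonempty (MvPolynomial.zeroLocus ℚ surfaceU50) :=
  ⟨⟨![2, 2, -2], (mem_zeroLocus_surfaceU50 _).mpr (by simp; norm_num)⟩⟩

theorem mainTheorem10 :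
    ¬ SatisfiesWeakApproximation surfaceU50 ∧
    (∀ S : Finset RatPlace, RatPlace.finite 2 ∉ S →
      ¬ SatisfiesStrongApproximationOff surfaceU50 S) ∧
    (fun x : Fin 3 → ℝ => realInvariant ((2 + x 2 / x 0) * (x 2 / x 0)) (-6)) ''
        {x | x ∈ MvPolynomial.zeroLocus ℝ surfaceU50 ∧ x 0 ≠ 0 ∧
          (2 + x 2 / x 0) * (x 2 / x 0) ≠ 0} =
      {0, ((1 / 2 : ℚ) : AddCircle (1 : ℚ))} := by
  refine ⟨fun h => not_denseRange_ratToLocal_surfaceU50_two (h.denseRange_ratToLocal _),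
    fun S hS h => not_denseRange_ratToLocal_surfaceU50_two (h.denseRange_ratToLocal hS), ?_⟩
  apply Set.Subset.antisymm
  · rintro _ ⟨x, ⟨-, -, hx⟩, rfl⟩
    rcases lt_or_gt_of_ne hx with h | h
    · exact .inr (realInvariant_of_neg h (by norm_num))
    · exact .inl (realInvariant_of_pos h (by norm_num))
  · rintro _ (rfl | rfl)
    -- Here x₃/x₁ = 1 gives first entry 3; at the next point x₃/x₁ = -1 gives -1.
    · refine ⟨![2, -2, 2], ⟨(mem_zeroLocus_surfaceU50 _).mpr (by simp; norm_num), by simp,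
        by simp; norm_num⟩, realInvariant_of_pos (by simp; norm_num) (by norm_num)⟩
    · refine ⟨![2, 2, -2], ⟨(mem_zeroLocus_surfaceU50 _).mpr (by simp; norm_num), by simp,
        by simp; norm_num⟩, realInvariant_of_neg (by simp) (by norm_num)⟩
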